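/- **Corollary 2.15 (convexity of q-MLR).** For $n\in\mathbb N$ a matrix in $\mathbb C^{2^n\times 2^n}$ is regarded as acting on $n$ qubits. A *state* is a sequence $\rho=(\rho_n)_{n\in\mathbb N}$ of density matrices (positive semidefinite, trace $1$) $\rho_n\in\mathbb C^{2^n\times 2^n}$ such that, for every $n$, $\rho_n$ is the partial trace of $\rho_{n+1}$ over the last qubit; $\tau$ is the state with $\tau_n=2^{-n}I$. A *special projection* is a Hermitian projection matrix with complex algebraic entries; through a computable presentation of the complex algebraic numbers one speaks of computable sequences of special projections. A *quantum $\Sigma^0_1$ set* is a computable sequence $G=(p_n)_{n\in\mathbb N}$ of special projections $p_n\in\mathbb C^{2^n\times 2^n}$ with $\operatorname{range}(p_n\otimes I_2)\subseteq\operatorname{range}(p_{n+1})$ for all $n$, and $\rho(G):=\lim_n\operatorname{Tr}(\rho_np_n)$ for a state $\rho$. A *quantum Martin-Löf test* is a (uniformly) computable sequence $(S^m)_{m\in\mathbb N}$ of quantum $\Sigma^0_1$ sets with $\tau(S^m)\le 2^{-m}$ for all $m$. A state $\rho$ is *quantum Martin-Löf random* if $\inf_{m}\rho(S^m)=0$ for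 every quantum Martin-Löf test $(S^m)_{m\in\mathbb N}$. Let $k\in\mathbb N$, let $\rho^i$ ($i<k$) be quantum Martin-Löf random states, and let $\alpha_i\ge 0$ ($i<k$) be real numbers with $\sum_{i<k}\alpha_i=1$. Then the state $\rho=\sum_{i<k}\alpha_i\rho^i$, that is, $\rho_n=\sum_{i<k}\alpha_i\rho^i_n$ for all $n$, is quantum Martin-Löf random. -/

import Mathlib

namespace QRandom

open scoped Kronecker ComplexOrder

/-! ### Complex algebraic numbers and their computable presentation -/

/-- Value at `z` of the polynomial `a₀ + a₁ X + a₂ X² + ⋯` with integer coefficients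
`[a₀, a₁, a₂, …]` (Horner's rule). -/
noncomputable def polyValue (p : List ℤ) (z : ℂ) : ℂ :=
  p.foldr (fun (a : ℤ) (s : ℂ) => (a : ℂ) + z * s) 0

open Classical in
/-- The root of the integer polynomial `p` in the open disc with centre `(a + b i) / (N + 1)` and
radius `1 / (N + 1)`, if the disc contains exactly one root of `p`; otherwise `0`. -/
noncomputable def isolatedRoot (p : List ℤ) (a b : ℤ) (N : ℕ) : ℂ :=
  if h : ∃! z : ℂ, polyValue p z = 0 ∧
      ‖((N : ℂ) + 1) * z - ((a : ℂ) + (b : ℂ) * Complex.I)‖ < 1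
  then h.choose else 0

/-- Finite expressions for complex algebraic numbers: isolated roots of integer polynomials, and
the operations of the field of algebraic numbers. -/
inductive AlgExpr : Type
  | root (p : List ℤ) (a b : ℤ) (N : ℕ) : AlgExpr
  | add (s t : AlgExpr) : AlgExpr
  | mul (s t : AlgExpr) : AlgExpr
  | inv (s : AlgExpr) : AlgExpr
  | conj (s : AlgExpr) : AlgExpr

/-- The algebraic number denoted by an expression (with `0⁻¹ = 0`). -/
noncomputable def AlgExpr.value : AlgExpr → ℂ
  | .root p a b N => isolatedRoot p a b N
  | .add s t => s.value + t.value
  | .mul s t => s.value * t.value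
  | .inv s => s.value⁻¹
  | .conj s => (starRingEnd ℂ) s.value

/-- The expression with code `n`: the remainder mod 5 selects the constructor and the quotient
codes the arguments; the code `0` is used for an expression of value `0`. -/
def AlgExpr.ofNat : ℕ → AlgExpr
  | 0 => .root [] 0 0 0
  | n + 1 =>
    have _h1 : (n / 5).unpair.1 < n + 1 :=
      Nat.lt_succ_of_le ((Nat.unpair_left_le _).trans (Nat.div_le_self n 5))
    have _h2 : (n / 5).unpair.2 < n + 1 :=
      Nat.lt_succ_of_le ((Nat.unpair_right_le _).trans (Nat.div_le_self n 5))
    have _h3 : n / 5 < n + 1 := Nat.lt_succ_of_le (Nat.div_le_self n 5)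
    match n % 5 with
    | 0 =>
      let d := Denumerable.ofNat (List ℤ × ℤ × ℤ × ℕ) (n / 5)
      .root d.1 d.2.1 d.2.2.1 d.2.2.2
    | 1 => .add (AlgExpr.ofNat (n / 5).unpair.1) (AlgExpr.ofNat (n / 5).unpair.2)
    | 2 => .mul (AlgExpr.ofNat (n / 5).unpair.1) (AlgExpr.ofNat (n / 5).unpair.2)
    | 3 => .inv (AlgExpr.ofNat (n / 5))
    | _ => .conj (AlgExpr.ofNat (n / 5))
  termination_by n => n

/-- The numbering `ℕ → ℂ` of the complex algebraic numbers by natural numbers. Isolation of roots,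
the field operations, conjugation and equality of algebraic numbers are all effective, so this is
(up to computable translation of codes) the usual computable presentation in which an algebraic
number is given by an integer polynomial and an isolating disc; every algebraic number has
a code that is a single isolated root. -/
noncomputable def algNumber (n : ℕ) : ℂ := (AlgExpr.ofNat n).value

/-! ### Qubits, states, special projections -/

/-- Square complex matrices acting on `n` qubits. -/
abbrev QMatrix (n : ℕ) : Type := Matrix (Fin (2 ^ n)) (Fin (2 ^ n)) ℂ

/-- The computational basis of `ℂ^(2^n) ⊗ ℂ²` as that of `ℂ^(2^(n+1))`:
`(i, b)` is sent to `2 i + b`. -/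
def appendQubit (n : ℕ) : Fin (2 ^ n) × Fin 2 ≃ Fin (2 ^ (n + 1)) :=
  finProdFinEquiv.trans (finCongr (pow_succ 2 n).symm)

/-- `A ⊗ I`, where `I` is the identity on one more (last) qubit. -/
def tensorOne {n : ℕ} (A : QMatrix n) : QMatrix (n + 1) :=
  Matrix.reindex (appendQubit n) (appendQubit n) (A ⊗ₖ (1 : Matrix (Fin 2) (Fin 2) ℂ))

/-- The partial trace over the last qubit. -/
def partialTrace {n : ℕ} (A : QMatrix (n + 1)) : QMatrix n :=
  Matrix.of fun i j => ∑ b : Fin 2, A (appendQubit n (i, b)) (appendQubit n (j, b))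

/-- A state: a coherent sequence of density matrices. -/
structure QState where
  mat : (n : ℕ) → QMatrix n
  posSemidef : ∀ n, (mat n).PosSemidef
  trace_eq_one : ∀ n, (mat n).trace = 1
  coherent : ∀ n, partialTrace (mat (n + 1)) = mat n

/-- The tracial state `τ`, with `τ_n = 2⁻ⁿ I`. -/
noncomputable def tracialState : QState where
  mat n := ((2 : ℂ) ^ n)⁻¹ • (1 : QMatrix n)
  posSemidef n := by
    refine Matrix.PosSemidef.one.smul ?_
    have : ((2 : ℂ) ^ n)⁻¹ = (((2 : ℝ) ^ n)⁻¹ : ℝ) := by push_cast; rfl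
    rw [this]
    exact_mod_cast (by positivity : (0 : ℝ) ≤ ((2 : ℝ) ^ n)⁻¹)
  trace_eq_one n := by
    simp [Matrix.trace_smul, Matrix.trace_one]
  coherent n := by
    ext i j
    by_cases h : i = j
    · subst h
      simp [partialTrace, Matrix.one_apply, pow_succ]
    · simp [partialTrace, Matrix.one_apply, h]

/-- The convex combination `∑ i, α i • ρ i` of finitely many states. -/
noncomputable def QState.convexComb {k : ℕ} (ρ : Fin k → QState) (α : Fin k → ℝ)
    (hα : ∀ i, 0 ≤ α i) (hsum : ∑ i, α i = 1) : QState where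
  mat n := ∑ i, (α i : ℂ) • (ρ i).mat n
  posSemidef n := Matrix.posSemidef_sum _ fun i _ =>
    ((ρ i).posSemidef n).smul (by exact_mod_cast hα i)
  trace_eq_one n := by
    simp only [Matrix.trace_sum, Matrix.trace_smul, (ρ _).trace_eq_one n, smul_eq_mul, mul_one]
    exact_mod_cast hsum
  coherent n := by
    ext i j
    have h : ∀ l, ∑ b : Fin 2,
        (ρ l).mat (n + 1) (appendQubit n (i, b)) (appendQubit n (j, b)) = (ρ l).mat n i j :=
      fun l => congrFun (congrFun ((ρ l).coherent n) i) j
    simp only [partialTrace, Matrix.of_apply, Matrix.sum_apply, Matrix.smul_apply, smul_eq_mul]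
    rw [Finset.sum_comm]
    simp only [← Finset.mul_sum, h]

/-- A special projection: a hermitian projection matrix with complex algebraic entries. -/
def IsSpecialProjection {n : ℕ} (p : QMatrix n) : Prop :=
  p.IsHermitian ∧ p * p = p ∧ ∀ i j, IsAlgebraic ℚ (p i j)

/-! ### Quantum `Σ⁰₁` sets and quantum Martin-Löf tests -/

/-- A quantum `Σ⁰₁` set: a computable sequence `p n` of special projections, `p n` on `n` qubits,
with `range (p n ⊗ I) ⊆ range (p (n + 1))`. -/
structure QSigma where
  proj : (n : ℕ) → QMatrix n
  special : ∀ n, IsSpecialProjection (proj n)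
  computable : ∃ f : ℕ × ℕ × ℕ → ℕ, Computable f ∧
    ∀ (n : ℕ) (i j : Fin (2 ^ n)), proj n i j = algNumber (f (n, (i : ℕ), (j : ℕ)))
  range_le : ∀ n, LinearMap.range (Matrix.mulVecLin (tensorOne (proj n))) ≤
    LinearMap.range (Matrix.mulVecLin (proj (n + 1)))

/-- `ρ(G) = lim_n Tr(ρ_n p_n)`. The traces are real, and they form a bounded nondecreasing
sequence, so the limit exists. -/
noncomputable def QState.measure (ρ : QState) (G : QSigma) : ℝ :=
  Filter.limUnder Filter.atTop fun n => (Matrix.trace (ρ.mat n * G.proj n)).re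

/-- A computable sequence of quantum `Σ⁰₁` sets: the special projections are computable uniformly
in both indices. -/
def IsComputableSeq (S : ℕ → QSigma) : Prop :=
  ∃ f : ℕ × ℕ × ℕ × ℕ → ℕ, Computable f ∧
    ∀ (m n : ℕ) (i j : Fin (2 ^ n)),
      (S m).proj n i j = algNumber (f (m, n, (i : ℕ), (j : ℕ)))

/-- A quantum Martin-Löf test. -/
def IsQMLTest (S : ℕ → QSigma) : Prop :=
  IsComputableSeq S ∧ ∀ m, tracialState.measure (S m) ≤ ((2 : ℝ) ^ m)⁻¹

/-- Quantum Martin-Löf randomness of a state. -/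
def IsQMLRandom (ρ : QState) : Prop :=
  ∀ S : ℕ → QSigma, IsQMLTest S → (⨅ m, ρ.measure (S m)) = 0

end QRandom

namespace QRandom

open scoped Kronecker ComplexOrder

/-! ### Arithmetic on codes of algebraic numbers -/

/-! The measure of a fixed set is linear in the state (`QState.measure_convexComb`). This is not
enough by itself: the measures for different `i` could be small at different indices `m`. So the
infimum is upgraded to a limit: for a random state the measures of every test tend to zero
(`IsQMLRandom.tendsto_measure_zero`), and limits pass to finite linear combinations.

For the upgrade, replace `S m` by the join of all `S k` with `k > m`. These tail joins decrease with
`m`, so for a random state their infimum zero is a limit, and the tail join at `m` dominates `S (m +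
1)`. They form a test (`isQMLTest_tailJoin`): under the tracial state the measure is normalized
rank, rank is subadditive under joins, and the bounds `2⁻ᵏ` for `k > m` sum to `2⁻ᵐ`.

The laborious point is that joins are computable. At level `n` only `m < k < n` are joined, so the
projection comes from finitely many columns by Gram–Schmidt, carried out on codes of algebraic
numbers. With `0⁻¹ = 0`, dependent columns need no zero test. -/

theorem isolatedRoot_eq_zero {p : List ℤ} (hp : ∀ z, polyValue p z = 0) (a b : ℤ) (N : ℕ) :
    isolatedRoot p a b N = 0 := by
  unfold isolatedRoot
  rw [dif_neg]
  rintro ⟨z, ⟨-, hz⟩, huniq⟩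
  -- If every point is a root, a unique root in the disc would make this open disc a singleton.
  have hopen : IsOpen {y : ℂ | ‖((N : ℂ) + 1) * y - ((a : ℂ) + (b : ℂ) * Complex.I)‖ < 1} :=
    isOpen_lt (by fun_prop) continuous_const
  have hsub : {y : ℂ | ‖((N : ℂ) + 1) * y - ((a : ℂ) + (b : ℂ) * Complex.I)‖ < 1} = {z} := by
    ext y
    refine ⟨fun hy => huniq y ⟨hp y, hy⟩, ?_⟩
    rintro rfl
    exact hz
  rw [hsub] at hopen
  exact not_isOpen_singleton z hopen

theorem polyValue_isolatedRoot {p : List ℤ} {a b : ℤ} {N : ℕ} (h : ∃! z : ℂ, polyValue p z = 0 ∧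
    ‖((N : ℂ) + 1) * z - ((a : ℂ) + (b : ℂ) * Complex.I)‖ < 1) :
    polyValue p (isolatedRoot p a b N) = 0 := by
  rw [isolatedRoot, dif_pos h]
  exact h.choose_spec.1.1

/-- This makes the code `0` a safe default for empty sums, missing list entries and suppressed
columns. -/
theorem algNumber_zero : algNumber 0 = 0 := by
  rw [algNumber, AlgExpr.ofNat, AlgExpr.value, isolatedRoot_eq_zero fun _ => rfl]

/-- The code of the sum of the numbers coded by `a` and `b`. -/
def addCode (a b : ℕ) : ℕ := 5 * Nat.pair a b + 1 + 1

/-- The code of the product of the numbers coded by `a` and `b`. -/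
def mulCode (a b : ℕ) : ℕ := 5 * Nat.pair a b + 2 + 1

/-- The code of the inverse of the number coded by `a`. -/
def invCode (a : ℕ) : ℕ := 5 * a + 3 + 1

/-- The code of the complex conjugate of the number coded by `a`. -/
def conjCode (a : ℕ) : ℕ := 5 * a + 4 + 1

theorem algNumber_addCode (a b : ℕ) : algNumber (addCode a b) = algNumber a + algNumber b := by
  have h₁ : (5 * Nat.pair a b + 1) % 5 = 1 := by omega
  have h₂ : (5 * Nat.pair a b + 1) / 5 = Nat.pair a b := by omega
  rw [algNumber, addCode, AlgExpr.ofNat, h₁, h₂]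
  simp [AlgExpr.value, algNumber]

theorem algNumber_mulCode (a b : ℕ) : algNumber (mulCode a b) = algNumber a * algNumber b := by
  have h₁ : (5 * Nat.pair a b + 2) % 5 = 2 := by omega
  have h₂ : (5 * Nat.pair a b + 2) / 5 = Nat.pair a b := by omega
  rw [algNumber, mulCode, AlgExpr.ofNat, h₁, h₂]
  simp [AlgExpr.value, algNumber]

theorem algNumber_invCode (a : ℕ) : algNumber (invCode a) = (algNumber a)⁻¹ := by
  have h₁ : (5 * a + 3) % 5 = 3 := by omega
  have h₂ : (5 * a + 3) / 5 = a := by omega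
  rw [algNumber, invCode, AlgExpr.ofNat, h₁, h₂]
  simp [AlgExpr.value, algNumber]

theorem algNumber_conjCode (a : ℕ) : algNumber (conjCode a) = star (algNumber a) := by
  have h₁ : (5 * a + 4) % 5 = 4 := by omega
  have h₂ : (5 * a + 4) / 5 = a := by omega
  rw [algNumber, conjCode, AlgExpr.ofNat, h₁, h₂]
  simp [AlgExpr.value, algNumber]

/-- Expressions have no subtraction, so Gram–Schmidt needs a code of `-1`; it is the root of `1 +
X`. -/
theorem isolatedRoot_neg_one : isolatedRoot [1, 1] (-1) 0 0 = -1 := by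
  have h : ∃! z : ℂ, polyValue [1, 1] z = 0 ∧
      ‖(((0 : ℕ) : ℂ) + 1) * z - (((-1 : ℤ) : ℂ) + ((0 : ℤ) : ℂ) * Complex.I)‖ < 1 := by
    refine ⟨-1, by simp [polyValue], ?_⟩
    rintro y ⟨hy, -⟩
    simp only [polyValue, List.foldr] at hy
    push_cast at hy
    linear_combination hy
  have := polyValue_isolatedRoot h
  simp only [polyValue, List.foldr] at this
  push_cast at this
  linear_combination this

theorem exists_algNumber_eq_neg_one : ∃ c, algNumber c = -1 := by
  obtain ⟨e, he⟩ : ∃ e, Denumerable.ofNat (List ℤ × ℤ × ℤ × ℕ) e = ([1, 1], -1, 0, 0) :=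
    ⟨_, Denumerable.ofNat_encode _⟩
  have h₁ : 5 * e % 5 = 0 := by omega
  have h₂ : 5 * e / 5 = e := by omega
  refine ⟨5 * e + 1, ?_⟩
  rw [algNumber, AlgExpr.ofNat, h₁, h₂, he]
  exact isolatedRoot_neg_one

/-- A code of the number `-1`. -/
noncomputable def negOneCode : ℕ := exists_algNumber_eq_neg_one.choose

theorem algNumber_negOneCode : algNumber negOneCode = -1 :=
  exists_algNumber_eq_neg_one.choose_spec

/-- The code of the sum of the numbers coded by `c 0, …, c (N - 1)`. -/
def sumCode (N : ℕ) (c : ℕ → ℕ) : ℕ := Nat.rec 0 (fun l s => addCode s (c l)) N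

theorem algNumber_sumCode (N : ℕ) (c : ℕ → ℕ) :
    algNumber (sumCode N c) = ∑ l : Fin N, algNumber (c l) := by
  rw [Fin.sum_univ_eq_sum_range (fun l => algNumber (c l))]
  induction N with
  | zero => exact algNumber_zero
  | succ N ih => rw [Finset.sum_range_succ, ← ih, ← algNumber_addCode]; rfl

/-! ### Every code denotes an algebraic number -/

theorem polyValue_eq_aeval (p : List ℤ) (z : ℂ) :
    polyValue p z = Polynomial.aeval z
      (p.foldr (fun (a : ℤ) (s : Polynomial ℚ) => Polynomial.C (a : ℚ) + Polynomial.X * s) 0) := by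
  induction p with
  | nil => simp [polyValue]
  | cons a p ih =>
    rw [polyValue] at ih ⊢
    simp [ih]

/-- The list may represent the zero polynomial, which witnesses nothing; but then no root is
isolated and the value is the default `0`. -/
theorem isAlgebraic_isolatedRoot (p : List ℤ) (a b : ℤ) (N : ℕ) :
    IsAlgebraic ℚ (isolatedRoot p a b N) := by
  by_cases h : ∃! z : ℂ, polyValue p z = 0 ∧
      ‖((N : ℂ) + 1) * z - ((a : ℂ) + (b : ℂ) * Complex.I)‖ < 1
  · by_cases hp : p.foldr
        (fun (a : ℤ) (s : Polynomial ℚ) => Polynomial.C (a : ℚ) + Polynomial.X * s) 0 = 0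
    · rw [isolatedRoot_eq_zero fun z => by rw [polyValue_eq_aeval, hp, map_zero]]
      exact isAlgebraic_zero
    · exact ⟨_, hp, by rw [← polyValue_eq_aeval]; exact polyValue_isolatedRoot h⟩
  · rw [isolatedRoot, dif_neg h]
    exact isAlgebraic_zero

theorem AlgExpr.isAlgebraic_value (e : AlgExpr) : IsAlgebraic ℚ e.value := by
  induction e with
  | root p a b N => exact isAlgebraic_isolatedRoot p a b N
  | add s t hs ht => exact hs.add ht
  | mul s t hs ht => exact hs.mul ht
  | inv s hs => exact hs.inv
  | conj s hs =>
    exact hs.algHom (Complex.conjAe.toAlgHom.restrictScalars ℚ)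

theorem isAlgebraic_algNumber (n : ℕ) : IsAlgebraic ℚ (algNumber n) :=
  AlgExpr.isAlgebraic_value _

/-! ### Computability of the operations on codes -/

section Computability

variable {β : Type*} [Primcodable β]

theorem primrec_addCode : Primrec₂ addCode :=
  Primrec.succ.comp (Primrec.nat_add.comp (Primrec.nat_mul.comp (Primrec.const 5)
    Primrec₂.natPair) (Primrec.const 1))

theorem primrec_mulCode : Primrec₂ mulCode :=
  Primrec.succ.comp (Primrec.nat_add.comp (Primrec.nat_mul.comp (Primrec.const 5)
    Primrec₂.natPair) (Primrec.const 2))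

theorem primrec_invCode : Primrec invCode :=
  Primrec.succ.comp (Primrec.nat_add.comp (Primrec.nat_mul.comp (Primrec.const 5)
    Primrec.id) (Primrec.const 3))

theorem primrec_conjCode : Primrec conjCode :=
  Primrec.succ.comp (Primrec.nat_add.comp (Primrec.nat_mul.comp (Primrec.const 5)
    Primrec.id) (Primrec.const 4))

theorem _root_.Computable.addCode {f g : β → ℕ} (hf : Computable f) (hg : Computable g) :
    Computable fun a => addCode (f a) (g a) :=
  primrec_addCode.to_comp.comp hf hg

theorem _root_.Computable.mulCode {f g : β → ℕ} (hf : Computable f) (hg : Computable g) :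
    Computable fun a => mulCode (f a) (g a) :=
  primrec_mulCode.to_comp.comp hf hg

theorem _root_.Computable.invCode {f : β → ℕ} (hf : Computable f) :
    Computable fun a => invCode (f a) :=
  primrec_invCode.to_comp.comp hf

theorem _root_.Computable.conjCode {f : β → ℕ} (hf : Computable f) :
    Computable fun a => conjCode (f a) :=
  primrec_conjCode.to_comp.comp hf

theorem _root_.Computable.sumCode {N : β → ℕ} {c : β → ℕ → ℕ} (hN : Computable N)
    (hc : Computable₂ c) : Computable fun a => sumCode (N a) (c a) :=
  Computable.nat_rec hN (Computable.const 0)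
    (Computable.addCode (Computable.snd.comp Computable.snd)
      (hc.comp Computable.fst (Computable.fst.comp Computable.snd))).to₂

theorem _root_.Computable.list_map_range {γ : Type*} [Primcodable γ] {N : β → ℕ} {c : β → ℕ → γ}
    (hN : Computable N) (hc : Computable₂ c) :
    Computable fun a => (List.range (N a)).map (c a) := by
  have h : Computable fun a =>
      (Nat.rec [] (fun l s => s ++ [c a l]) (N a) : List γ) :=
    Computable.nat_rec hN (Computable.const [])
      (Computable.list_append.comp (Computable.snd.comp Computable.snd)
        (Computable.list_cons.comp (hc.comp Computable.fst (Computable.fst.comp Computable.snd))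
          (Computable.const []))).to₂
  refine h.of_eq fun a => ?_
  induction N a with
  | zero => rfl
  | succ n ih => simp only [List.range_succ, List.map_append, List.map_cons, List.map_nil, ← ih]

end Computability

/-! ### Gram–Schmidt projections -/

section GramSchmidt

variable {ι : Type*} [Fintype ι]

/-- If `P` is a hermitian projection, this is the hermitian projection onto the sum of the range
of `P` and the line spanned by `v`. -/
noncomputable def extendProj (P : Matrix ι ι ℂ) (v : ι → ℂ) : Matrix ι ι ℂ :=
  P + (star (v - P.mulVec v) ⬝ᵥ (v - P.mulVec v))⁻¹ •
    Matrix.vecMulVec (v - P.mulVec v) (star (v - P.mulVec v))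

/-- The hermitian projection onto the span of `v 0, …, v (t - 1)`. -/
noncomputable def spanProj (v : ℕ → ι → ℂ) (t : ℕ) : Matrix ι ι ℂ :=
  Nat.rec 0 (fun t P => extendProj P (v t)) t

theorem spanProj_succ (v : ℕ → ι → ℂ) (t : ℕ) :
    spanProj v (t + 1) = extendProj (spanProj v t) (v t) := rfl

theorem star_dotProduct_self_eq_ofReal (w : ι → ℂ) :
    star (star w ⬝ᵥ w) = star w ⬝ᵥ w := by
  rw [← Matrix.star_dotProduct_star, star_star]

theorem isHermitian_extendProj {P : Matrix ι ι ℂ} (hP : P.IsHermitian) (v : ι → ℂ) :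
    (extendProj P v).IsHermitian := by
  refine hP.add ?_
  rw [Matrix.IsHermitian, Matrix.conjTranspose_smul, Matrix.conjTranspose_vecMulVec, star_star,
    star_inv₀, star_dotProduct_self_eq_ofReal]

theorem mulVec_sub_mulVec {P : Matrix ι ι ℂ} (hPP : P * P = P) (v : ι → ℂ) :
    P.mulVec (v - P.mulVec v) = 0 := by
  rw [Matrix.mulVec_sub, Matrix.mulVec_mulVec, hPP, sub_self]

/-- The residual `w = v - P v` is orthogonal to the range of `P`, so the cross terms vanish. The
normalized rank-one term is idempotent, also for `w = 0`, where `0⁻¹ = 0` makes it zero. -/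
theorem extendProj_mul_self {P : Matrix ι ι ℂ} (hP : P.IsHermitian) (hPP : P * P = P)
    (v : ι → ℂ) : extendProj P v * extendProj P v = extendProj P v := by
  have hw := mulVec_sub_mulVec hPP v
  unfold extendProj
  set w := v - P.mulVec v
  have hw' : Matrix.vecMul (star w) P = 0 := by
    rw [← hP.eq, ← Matrix.star_mulVec, hw, star_zero]
  have hsq : ((star w ⬝ᵥ w)⁻¹ * (star w ⬝ᵥ w)) • ((star w ⬝ᵥ w)⁻¹ • Matrix.vecMulVec w (star w)) =
      (star w ⬝ᵥ w)⁻¹ • Matrix.vecMulVec w (star w) := by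
    by_cases h : star w ⬝ᵥ w = 0
    · simp [h]
    · rw [inv_mul_cancel₀ h, one_smul]
  rw [Matrix.add_mul, Matrix.mul_add, Matrix.mul_add, hPP, Matrix.mul_smul, Matrix.mul_vecMulVec,
    hw, Matrix.smul_mul, Matrix.vecMulVec_mul, hw', Matrix.smul_mul, Matrix.mul_smul,
    Matrix.vecMulVec_mul_vecMulVec, Matrix.vecMulVec_smul, Matrix.zero_vecMulVec,
    Matrix.vecMulVec_zero, smul_zero, add_zero, zero_add]
  conv_rhs => rw [← hsq]
  simp only [smul_smul]
  congr 2
  ring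

theorem range_extendProj {P : Matrix ι ι ℂ} (hP : P.IsHermitian) (hPP : P * P = P) (v : ι → ℂ) :
    LinearMap.range (extendProj P v).mulVecLin = LinearMap.range P.mulVecLin ⊔ ℂ ∙ v := by
  set w := v - P.mulVec v with hw
  have hact : ∀ x, (extendProj P v).mulVec x =
      P.mulVec x + ((star w ⬝ᵥ w)⁻¹ * (star w ⬝ᵥ x)) • w := fun x => by
    rw [extendProj, Matrix.add_mulVec, Matrix.smul_mulVec, Matrix.vecMulVec_mulVec, ← hw,
      op_smul_eq_smul, smul_smul]
  have horth : ∀ x, star w ⬝ᵥ P.mulVec x = 0 := fun x => by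
    rw [Matrix.dotProduct_mulVec, ← hP.eq, ← Matrix.star_mulVec, hw, mulVec_sub_mulVec hPP,
      star_zero, zero_dotProduct]
  have hv : v = P.mulVec v + w := by rw [hw, add_sub_cancel]
  apply le_antisymm
  · rintro _ ⟨x, rfl⟩
    rw [Matrix.mulVecLin_apply, hact, hw, smul_sub, ← Matrix.mulVec_smul, add_sub_left_comm,
      ← Matrix.mulVec_sub, add_comm]
    exact Submodule.add_mem_sup ⟨_, rfl⟩
      (Submodule.smul_mem _ _ (Submodule.mem_span_singleton_self v))
  · refine sup_le ?_ ?_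
    · rintro _ ⟨x, rfl⟩
      refine ⟨P.mulVec x, ?_⟩
      simp [hact, horth, Matrix.mulVec_mulVec, hPP]
    · rw [Submodule.span_singleton_le_iff_mem]
      refine ⟨v, ?_⟩
      have hwv : star w ⬝ᵥ v = star w ⬝ᵥ w := by
        conv_lhs => rw [hv, dotProduct_add, horth, zero_add]
      rw [Matrix.mulVecLin_apply, hact, hwv]
      -- If the residual vanishes, `v` already lies in the range of `P`.
      by_cases h : star w ⬝ᵥ w = 0
      · have hw₀ : w = 0 := dotProduct_star_self_eq_zero.1 h
        rw [hw₀, add_zero] at hv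
        rw [hw₀, smul_zero, add_zero, ← hv]
      · rw [inv_mul_cancel₀ h, one_smul, ← hv]

theorem isHermitian_spanProj_and (v : ℕ → ι → ℂ) (t : ℕ) :
    (spanProj v t).IsHermitian ∧ spanProj v t * spanProj v t = spanProj v t := by
  induction t with
  | zero => exact ⟨Matrix.isHermitian_zero, mul_zero _⟩
  | succ t ih => exact ⟨isHermitian_extendProj ih.1 _, extendProj_mul_self ih.1 ih.2 _⟩

theorem range_spanProj (v : ℕ → ι → ℂ) (t : ℕ) :
    LinearMap.range (spanProj v t).mulVecLin = Submodule.span ℂ (v '' Set.Iio t) := by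
  induction t with
  | zero => simp [spanProj]
  | succ t ih =>
    have hIio : Set.Iio (t + 1) = insert t (Set.Iio t) := Order.Iio_succ_eq_insert t
    rw [spanProj_succ, range_extendProj (isHermitian_spanProj_and v t).1 (isHermitian_spanProj_and v t).2, ih,
      ← Submodule.span_union, hIio, Set.image_insert_eq, 
      Set.union_singleton]

end GramSchmidt

/-! ### Computing codes of the entries of Gram–Schmidt projections -/

/-- The code of entry `(i, j)` of an `N × N` matrix given by the list of codes of its entries. -/
def entryCode (N : ℕ) (M : List ℕ) (i j : ℕ) : ℕ := M.getD (i * N + j) 0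

/-- The matrix given by the list of codes of its entries. -/
noncomputable def codedMatrix (N : ℕ) (M : List ℕ) : Matrix (Fin N) (Fin N) ℂ :=
  Matrix.of fun i j => algNumber (entryCode N M i j)

/-- Codes of the entries of `v - P v`. -/
noncomputable def residualCode (N : ℕ) (M : List ℕ) (v : ℕ → ℕ) (i : ℕ) : ℕ :=
  addCode (v i) (mulCode negOneCode (sumCode N fun l => mulCode (entryCode N M i l) (v l)))

/-- Codes of the entries of `extendProj P v`. -/
noncomputable def extendCode (N : ℕ) (M : List ℕ) (v : ℕ → ℕ) : List ℕ :=
  (List.range (N * N)).map fun q =>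
    addCode (entryCode N M (q / N) (q % N))
      (mulCode
        (invCode (sumCode N fun l =>
          mulCode (conjCode (residualCode N M v l)) (residualCode N M v l)))
        (mulCode (residualCode N M v (q / N)) (conjCode (residualCode N M v (q % N)))))

/-- Codes of the entries of `spanProj v t`. -/
noncomputable def spanCode (N : ℕ) (v : ℕ → ℕ → ℕ) (t : ℕ) : List ℕ :=
  Nat.rec [] (fun t M => extendCode N M (v t)) t

/-- Lists are row-major: division and remainder by `N` recover `i` and `j` from position `i * N +
j`. -/
theorem codedMatrix_extendCode (N : ℕ) (M : List ℕ) (v : ℕ → ℕ) :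
    codedMatrix N (extendCode N M v) =
      extendProj (codedMatrix N M) fun i : Fin N => algNumber (v i) := by
  have hres : ∀ i : Fin N, algNumber (residualCode N M v i) =
      ((fun i : Fin N => algNumber (v i)) -
        (codedMatrix N M).mulVec fun i : Fin N => algNumber (v i)) i := fun i => by
    simp [residualCode, algNumber_addCode, algNumber_mulCode, algNumber_sumCode,
      algNumber_negOneCode, codedMatrix, Matrix.mulVec, dotProduct, sub_eq_add_neg]
  ext i j
  have hN : 0 < N := i.pos
  have hlt : (i : ℕ) * N + j < N * N := by
    nlinarith [i.isLt, j.isLt]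
  have hdiv : ((i : ℕ) * N + j) / N = i := by
    rw [mul_comm, Nat.mul_add_div hN, Nat.div_eq_of_lt j.isLt, add_zero]
  have hmod : ((i : ℕ) * N + j) % N = j := by
    rw [mul_comm, Nat.mul_add_mod, Nat.mod_eq_of_lt j.isLt]
  have hentry : entryCode N (extendCode N M v) i j =
      addCode (entryCode N M i j)
      (mulCode
        (invCode (sumCode N fun l =>
          mulCode (conjCode (residualCode N M v l)) (residualCode N M v l)))
        (mulCode (residualCode N M v i) (conjCode (residualCode N M v j)))) := by
    rw [entryCode, extendCode, List.getD_eq_getElem _ _ (by simpa using hlt)]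
    simp [hdiv, hmod]
  rw [codedMatrix, Matrix.of_apply, hentry]
  simp only [algNumber_addCode, algNumber_mulCode, algNumber_sumCode, algNumber_invCode,
    algNumber_conjCode, hres]
  rfl

theorem codedMatrix_spanCode (N : ℕ) (v : ℕ → ℕ → ℕ) (t : ℕ) :
    codedMatrix N (spanCode N v t) = spanProj (fun t (i : Fin N) => algNumber (v t i)) t := by
  induction t with
  | zero => ext i j; simp [codedMatrix, spanCode, spanProj, entryCode, algNumber_zero]
  | succ t ih => rw [spanProj_succ, ← ih]; exact codedMatrix_extendCode N _ (v t)

section Computability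

variable {β : Type*} [Primcodable β]

theorem _root_.Computable.entryCode {N : β → ℕ} {M : β → List ℕ} {i j : β → ℕ}
    (hN : Computable N) (hM : Computable M) (hi : Computable i) (hj : Computable j) :
    Computable fun a => entryCode (N a) (M a) (i a) (j a) :=
  (Primrec.list_getD 0).to_comp.comp hM
    (Primrec.nat_add.to_comp.comp (Primrec.nat_mul.to_comp.comp hi hN) hj)

theorem _root_.Computable.residualCode {N : β → ℕ} {M : β → List ℕ} {v : β → ℕ → ℕ} {i : β → ℕ}
    (hN : Computable N) (hM : Computable M) (hv : Computable₂ v) (hi : Computable i) :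
    Computable fun a => residualCode (N a) (M a) (v a) (i a) :=
  Computable.addCode (hv.comp Computable.id hi)
    -- `negOneCode` is obtained by choice, but any constant function is computable.
    (Computable.mulCode (Computable.const _) (Computable.sumCode hN (Computable.mulCode
      (Computable.entryCode (hN.comp Computable.fst) (hM.comp Computable.fst)
        (hi.comp Computable.fst) Computable.snd) hv).to₂))

theorem _root_.Computable.extendCode {N : β → ℕ} {M : β → List ℕ} {v : β → ℕ → ℕ}
    (hN : Computable N) (hM : Computable M) (hv : Computable₂ v) :
    Computable fun a => extendCode (N a) (M a) (v a) := by
  have hres : ∀ {i : β × ℕ → ℕ}, Computable i →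
      Computable fun x : β × ℕ => residualCode (N x.1) (M x.1) (v x.1) (i x) := fun hi =>
    Computable.residualCode (hN.comp Computable.fst) (hM.comp Computable.fst)
      (hv.comp (Computable.fst.comp Computable.fst) Computable.snd).to₂ hi
  have hnorm : Computable fun a => sumCode (N a) fun l =>
      mulCode (conjCode (residualCode (N a) (M a) (v a) l)) (residualCode (N a) (M a) (v a) l) :=
    Computable.sumCode hN
      (Computable.mulCode (hres Computable.snd).conjCode (hres Computable.snd)).to₂
  have hdiv : Computable fun x : β × ℕ => x.2 / N x.1 :=
    Primrec.nat_div.to_comp.comp Computable.snd (hN.comp Computable.fst)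
  have hmod : Computable fun x : β × ℕ => x.2 % N x.1 :=
    Primrec.nat_mod.to_comp.comp Computable.snd (hN.comp Computable.fst)
  exact Computable.list_map_range (Primrec.nat_mul.to_comp.comp hN hN)
    (Computable.addCode
      (Computable.entryCode (hN.comp Computable.fst) (hM.comp Computable.fst) hdiv hmod)
      (Computable.mulCode (hnorm.invCode.comp Computable.fst)
        (Computable.mulCode (hres hdiv) (hres hmod).conjCode))).to₂

/-- Keeping matrices as lists of codes lets the recursion run in one type although the dimension
varies with the input. -/
theorem _root_.Computable.spanCode {N : β → ℕ} {v : β → ℕ → ℕ → ℕ} {t : β → ℕ}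
    (hN : Computable N) (hv : Computable fun x : β × ℕ × ℕ => v x.1 x.2.1 x.2.2)
    (ht : Computable t) : Computable fun a => spanCode (N a) (v a) (t a) :=
  Computable.nat_rec ht (Computable.const [])
    (Computable.extendCode (hN.comp Computable.fst) (Computable.snd.comp Computable.snd)
      (hv.comp ((Computable.fst.comp Computable.fst).pair
        ((Computable.fst.comp (Computable.snd.comp Computable.fst)).pair
          Computable.snd))).to₂).to₂

end Computability

/-! ### Projections and traces -/

section Projections

variable {ι : Type*} [Fintype ι]

theorem mul_eq_of_range_le [DecidableEq ι] {P Q : Matrix ι ι ℂ} (hQQ : Q * Q = Q)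
    (h : LinearMap.range P.mulVecLin ≤ LinearMap.range Q.mulVecLin) : Q * P = P := by
  refine Matrix.ext_of_mulVec_single fun i => ?_
  obtain ⟨y, hy⟩ := h ⟨Pi.single i 1, rfl⟩
  simp only [Matrix.mulVecLin_apply] at hy
  rw [← Matrix.mulVec_mulVec, ← hy, Matrix.mulVec_mulVec, hQQ]

/-- By cyclicity the trace is that of the positive semidefinite matrix `P A P`. -/
theorem re_trace_mul_nonneg {A P : Matrix ι ι ℂ} (hA : A.PosSemidef) (hP : P.IsHermitian)
    (hPP : P * P = P) : 0 ≤ (Matrix.trace (A * P)).re := by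
  have h := (hA.mul_mul_conjTranspose_same P).trace_nonneg
  rw [hP.eq, Matrix.trace_mul_comm, ← Matrix.mul_assoc, hPP, Matrix.trace_mul_comm] at h
  exact (Complex.le_def.1 h).1

/-- Nested ranges make `Q - P` a hermitian projection as well. -/
theorem re_trace_mul_le_of_range_le [DecidableEq ι] {A P Q : Matrix ι ι ℂ}
    (hA : A.PosSemidef) (hP : P.IsHermitian) (hPP : P * P = P) (hQ : Q.IsHermitian) (hQQ : Q * Q = Q)
    (h : LinearMap.range P.mulVecLin ≤ LinearMap.range Q.mulVecLin) :
    (Matrix.trace (A * P)).re ≤ (Matrix.trace (A * Q)).re := by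
  have hQP := mul_eq_of_range_le hQQ h
  have hPQ : P * Q = P := by
    have := congrArg Matrix.conjTranspose hQP
    rwa [Matrix.conjTranspose_mul, hP.eq, hQ.eq] at this
  have := re_trace_mul_nonneg hA (hQ.sub hP) (by
    rw [Matrix.sub_mul, Matrix.mul_sub, Matrix.mul_sub, hQQ, hQP, hPQ, hPP, sub_self, sub_zero])
  rwa [Matrix.mul_sub, Matrix.trace_sub, Complex.sub_re, sub_nonneg] at this

theorem trace_eq_finrank_range [DecidableEq ι] {P : Matrix ι ι ℂ} (hPP : P * P = P) :
    Matrix.trace P = (Module.finrank ℂ (LinearMap.range P.mulVecLin) : ℂ) := by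
  have hproj : LinearMap.IsProj (LinearMap.range P.mulVecLin) P.mulVecLin :=
    ⟨fun x => ⟨x, rfl⟩, by
      rintro _ ⟨x, rfl⟩
      simp [Matrix.mulVec_mulVec, hPP]⟩
  rw [← hproj.trace, ← Matrix.toLin'_apply', Matrix.trace_toLin'_eq]

end Projections

/-! ### Appending a qubit -/

theorem isHermitian_tensorOne {n : ℕ} {A : QMatrix n} (hA : A.IsHermitian) :
    (tensorOne A).IsHermitian := by
  rw [Matrix.IsHermitian, tensorOne, Matrix.conjTranspose_reindex, Matrix.conjTranspose_kronecker,
    hA.eq, Matrix.conjTranspose_one]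

theorem tensorOne_mul_self {n : ℕ} {A : QMatrix n} (hA : A * A = A) :
    tensorOne A * tensorOne A = tensorOne A := by
  rw [tensorOne, Matrix.reindex_apply, Matrix.submatrix_mul_equiv, ← Matrix.mul_kronecker_mul, hA,
    one_mul]

theorem tensorOne_apply {n : ℕ} (A : QMatrix n) (i j : Fin (2 ^ n)) (b c : Fin 2) :
    tensorOne A (appendQubit n (i, b)) (appendQubit n (j, c)) = if b = c then A i j else 0 := by
  simp [tensorOne, Matrix.one_apply]

/-- Partial trace is dual to tensoring with the identity; through this, coherence of a state lets
levels `n` and `n + 1` be compared. -/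
theorem trace_mul_tensorOne {n : ℕ} (A : QMatrix (n + 1)) (P : QMatrix n) :
    Matrix.trace (A * tensorOne P) = Matrix.trace (partialTrace A * P) := by
  simp only [Matrix.trace, Matrix.diag, Matrix.mul_apply, ← (appendQubit n).sum_comp,
    Fintype.sum_prod_type, tensorOne_apply, partialTrace, Matrix.of_apply]
  refine Finset.sum_congr rfl fun i _ => ?_
  rw [Finset.sum_comm]
  refine Finset.sum_congr rfl fun j _ => ?_
  simp [add_mul]

/-- The linear map `v ↦ v ⊗ e_b`. -/
def appendVec (n : ℕ) (b : Fin 2) : (Fin (2 ^ n) → ℂ) →ₗ[ℂ] (Fin (2 ^ (n + 1)) → ℂ) where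
  toFun v x := if ((appendQubit n).symm x).2 = b then v ((appendQubit n).symm x).1 else 0
  map_add' u v := by ext x; by_cases h : ((appendQubit n).symm x).2 = b <;> simp [h]
  map_smul' c v := by ext x; by_cases h : ((appendQubit n).symm x).2 = b <;> simp [h]

theorem tensorOne_mulVec {n : ℕ} (A : QMatrix n) (x : Fin (2 ^ (n + 1)) → ℂ) :
    (tensorOne A).mulVec x =
      ∑ b, appendVec n b (A.mulVec fun i => x (appendQubit n (i, b))) := by
  ext y
  obtain ⟨⟨i, b⟩, rfl⟩ := (appendQubit n).surjective y
  simp only [Matrix.mulVec, dotProduct, ← (appendQubit n).sum_comp, Fintype.sum_prod_type,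
    tensorOne_apply, Finset.sum_apply, appendVec, LinearMap.coe_mk, AddHom.coe_mk,
    Equiv.symm_apply_apply]
  simp

theorem tensorOne_mulVec_appendVec {n : ℕ} (A : QMatrix n) (b : Fin 2) (v : Fin (2 ^ n) → ℂ) :
    (tensorOne A).mulVec (appendVec n b v) = appendVec n b (A.mulVec v) := by
  ext y
  obtain ⟨⟨i, c⟩, rfl⟩ := (appendQubit n).surjective y
  simp only [Matrix.mulVec, dotProduct, ← (appendQubit n).sum_comp, Fintype.sum_prod_type,
    tensorOne_apply, appendVec, LinearMap.coe_mk, AddHom.coe_mk, Equiv.symm_apply_apply]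
  by_cases h : c = b <;> simp [h]

theorem range_tensorOne {n : ℕ} (A : QMatrix n) :
    LinearMap.range (tensorOne A).mulVecLin =
      ⨆ b, (LinearMap.range A.mulVecLin).map (appendVec n b) := by
  apply le_antisymm
  · rintro _ ⟨x, rfl⟩
    rw [Matrix.mulVecLin_apply, tensorOne_mulVec]
    exact Submodule.sum_mem _ fun b _ => Submodule.mem_iSup_of_mem b ⟨_, ⟨_, rfl⟩, rfl⟩
  · refine iSup_le fun b => ?_
    rintro _ ⟨_, ⟨v, rfl⟩, rfl⟩
    exact ⟨appendVec n b v, tensorOne_mulVec_appendVec A b v⟩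

/-! ### The measure of a quantum `Σ⁰₁` set -/

theorem QSigma.monotone_re_trace (ρ : QState) (G : QSigma) :
    Monotone fun n => (Matrix.trace (ρ.mat n * G.proj n)).re := by
  refine monotone_nat_of_le_succ fun n => ?_
  rw [← ρ.coherent n, ← trace_mul_tensorOne]
  exact re_trace_mul_le_of_range_le (ρ.posSemidef _) (isHermitian_tensorOne (G.special n).1)
    (tensorOne_mul_self (G.special n).2.1) (G.special _).1 (G.special _).2.1 (G.range_le n)

theorem QSigma.re_trace_le_one (ρ : QState) (G : QSigma) (n : ℕ) :
    (Matrix.trace (ρ.mat n * G.proj n)).re ≤ 1 := by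
  have := re_trace_mul_le_of_range_le (ρ.posSemidef n) (G.special n).1 (G.special n).2.1
    Matrix.isHermitian_one (one_mul 1) (by simp)
  rwa [mul_one, ρ.trace_eq_one n, Complex.one_re] at this

/-- The traces are monotone and bounded by `1`, so `limUnder` is a genuine limit. -/
theorem QState.tendsto_measure (ρ : QState) (G : QSigma) :
    Filter.Tendsto (fun n => (Matrix.trace (ρ.mat n * G.proj n)).re) Filter.atTop
      (nhds (ρ.measure G)) :=
  tendsto_nhds_limUnder ⟨_, tendsto_atTop_ciSup (QSigma.monotone_re_trace ρ G)
    ⟨1, by rintro _ ⟨n, rfl⟩; exact G.re_trace_le_one ρ n⟩⟩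

theorem QState.re_trace_le_measure (ρ : QState) (G : QSigma) (n : ℕ) :
    (Matrix.trace (ρ.mat n * G.proj n)).re ≤ ρ.measure G :=
  (QSigma.monotone_re_trace ρ G).ge_of_tendsto (ρ.tendsto_measure G) n

theorem QState.measure_nonneg (ρ : QState) (G : QSigma) : 0 ≤ ρ.measure G :=
  ge_of_tendsto' (ρ.tendsto_measure G) fun n =>
    re_trace_mul_nonneg (ρ.posSemidef n) (G.special n).1 (G.special n).2.1

theorem QState.measure_mono (ρ : QState) {G H : QSigma}
    (h : ∀ᶠ n in Filter.atTop, LinearMap.range (G.proj n).mulVecLin ≤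
      LinearMap.range (H.proj n).mulVecLin) : ρ.measure G ≤ ρ.measure H :=
  le_of_tendsto_of_tendsto (ρ.tendsto_measure G) (ρ.tendsto_measure H) <| h.mono fun n hn =>
    re_trace_mul_le_of_range_le (ρ.posSemidef n) (G.special n).1 (G.special n).2.1
      (H.special n).1 (H.special n).2.1 hn

theorem QState.measure_convexComb {k : ℕ} (ρ : Fin k → QState) (α : Fin k → ℝ)
    (hα : ∀ i, 0 ≤ α i) (hsum : ∑ i, α i = 1) (G : QSigma) :
    (QState.convexComb ρ α hα hsum).measure G = ∑ i, α i * (ρ i).measure G := by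
  refine tendsto_nhds_unique (QState.tendsto_measure _ G) ?_
  refine (tendsto_finsetSum _ fun i _ => ((ρ i).tendsto_measure G).const_mul (α i)).congr
    fun n => ?_
  simp [QState.convexComb, Matrix.sum_mul, Matrix.trace_sum]

/-- Turns tracial measure into a dimension count. -/
theorem re_trace_tracialState_mul {n : ℕ} {P : QMatrix n} (hPP : P * P = P) :
    (Matrix.trace (tracialState.mat n * P)).re =
      ((2 : ℝ) ^ n)⁻¹ * Module.finrank ℂ (LinearMap.range P.mulVecLin) := by
  have h : ((2 : ℂ) ^ n)⁻¹ = (((2 : ℝ) ^ n)⁻¹ : ℝ) := by push_cast; rfl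
  rw [tracialState, Matrix.smul_mul, one_mul, Matrix.trace_smul, trace_eq_finrank_range hPP, h,
    smul_eq_mul, Complex.re_ofReal_mul, Complex.natCast_re]

/-! ### The tail joins of a quantum Martin-Löf test -/

/-- The sequence of all columns of the matrices `(S k).proj n`, `k = 0, 1, 2, …`, with those for
`k ≤ m` replaced by zero. -/
noncomputable def tailColumn (S : ℕ → QSigma) (m n t : ℕ) (i : Fin (2 ^ n)) : ℂ :=
  if m < t / 2 ^ n then (S (t / 2 ^ n)).proj n i (Fin.ofNat (2 ^ n) t) else 0

/-- The projection onto the sum of the ranges of `(S k).proj n` for `m < k < n`. -/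
noncomputable def tailProj (S : ℕ → QSigma) (m n : ℕ) : QMatrix n :=
  spanProj (tailColumn S m n) (n * 2 ^ n)

/-- An index `t < n * 2 ^ n` is uniquely `k * 2 ^ n + j` with `k < n` and `j < 2 ^ n`, and names
column `j` of `(S k).proj n`. -/
theorem range_tailProj (S : ℕ → QSigma) (m n : ℕ) :
    LinearMap.range (tailProj S m n).mulVecLin =
      (Finset.Ioo m n).sup fun k => LinearMap.range ((S k).proj n).mulVecLin := by
  rw [tailProj, range_spanProj]
  apply le_antisymm
  · rw [Submodule.span_le]
    rintro _ ⟨t, ht, rfl⟩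
    by_cases h : m < t / 2 ^ n
    · have hk : t / 2 ^ n ∈ Finset.Ioo m n :=
        Finset.mem_Ioo.2 ⟨h, Nat.div_lt_of_lt_mul (by rw [mul_comm]; exact ht)⟩
      refine Finset.le_sup (f := fun k => LinearMap.range ((S k).proj n).mulVecLin) hk
        ⟨Pi.single (Fin.ofNat (2 ^ n) t) 1, ?_⟩
      ext i
      simp [tailColumn, h]
    · have : tailColumn S m n t = 0 := by ext i; simp [tailColumn, h]
      rw [this]
      exact Submodule.zero_mem _
  · refine Finset.sup_le fun k hk => ?_
    rw [Finset.mem_Ioo] at hk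
    rw [Matrix.range_mulVecLin]
    refine Submodule.span_mono ?_
    rintro _ ⟨j, rfl⟩
    have hdiv : (k * 2 ^ n + j) / 2 ^ n = k := by
      rw [mul_comm, Nat.mul_add_div (by positivity), Nat.div_eq_of_lt j.isLt, add_zero]
    have hmod : Fin.ofNat (2 ^ n) (k * 2 ^ n + j) = j := by
      ext
      rw [Fin.val_ofNat, mul_comm, Nat.mul_add_mod, Nat.mod_eq_of_lt j.isLt]
    refine ⟨k * 2 ^ n + j, ?_, ?_⟩
    · calc k * 2 ^ n + j < (k + 1) * 2 ^ n := by rw [add_mul, one_mul]; gcongr; exact j.isLt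
        _ ≤ n * 2 ^ n := Nat.mul_le_mul_right _ hk.2
    · ext i
      rw [tailColumn, hdiv, hmod, if_pos hk.1]
      rfl

/-- Each `S k` already satisfies the inclusion, and passing to `n + 1` can only add a summand. -/
theorem range_tensorOne_tailProj_le (S : ℕ → QSigma) (m n : ℕ) :
    LinearMap.range (tensorOne (tailProj S m n)).mulVecLin ≤
      LinearMap.range (tailProj S m (n + 1)).mulVecLin := by
  rw [range_tensorOne, range_tailProj, range_tailProj]
  refine iSup_le fun b => ?_
  rw [Submodule.map_le_iff_le_comap]
  refine Finset.sup_le fun k hk => ?_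
  rw [← Submodule.map_le_iff_le_comap]
  rw [Finset.mem_Ioo] at hk
  calc (LinearMap.range ((S k).proj n).mulVecLin).map (appendVec n b)
      ≤ LinearMap.range (tensorOne ((S k).proj n)).mulVecLin := by
        rw [range_tensorOne]
        exact le_iSup (fun b => (LinearMap.range ((S k).proj n).mulVecLin).map (appendVec n b)) b
    _ ≤ LinearMap.range ((S k).proj (n + 1)).mulVecLin := (S k).range_le n
    _ ≤ _ := Finset.le_sup (f := fun k => LinearMap.range ((S k).proj (n + 1)).mulVecLin)
        (Finset.mem_Ioo.2 ⟨hk.1, hk.2.trans n.lt_succ_self⟩)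

/-- Codes of the columns `tailColumn S m n`, where `f` computes codes of the entries of `S`. -/
def tailColumnCode (f : ℕ × ℕ × ℕ × ℕ → ℕ) (m n t i : ℕ) : ℕ :=
  bif decide (m < t / 2 ^ n) then f (t / 2 ^ n, n, i, t % 2 ^ n) else 0

/-- Codes of the entries of `tailProj S m n`, where `f` computes codes of the entries of `S`. -/
noncomputable def tailProjCode (f : ℕ × ℕ × ℕ × ℕ → ℕ) (x : ℕ × ℕ × ℕ × ℕ) : ℕ :=
  entryCode (2 ^ x.2.1) (spanCode (2 ^ x.2.1) (tailColumnCode f x.1 x.2.1) (x.2.1 * 2 ^ x.2.1))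
    x.2.2.1 x.2.2.2

theorem computable_two_pow : Computable fun n : ℕ => 2 ^ n := by
  have h : Primrec fun n : ℕ => (Nat.rec 1 (fun _ s => s * 2) n : ℕ) :=
    Primrec.nat_rec' Primrec.id (Primrec.const 1)
      (Primrec.nat_mul.comp (Primrec.snd.comp Primrec.snd) (Primrec.const 2)).to₂
  refine h.to_comp.of_eq fun n => ?_
  induction n with
  | zero => rfl
  | succ n ih => rw [pow_succ, ← ih]

theorem computable_tailProjCode {f : ℕ × ℕ × ℕ × ℕ → ℕ} (hf : Computable f) :
    Computable (tailProjCode f) := by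
  have hn : Computable fun x : ℕ × ℕ × ℕ × ℕ => x.2.1 := Computable.fst.comp Computable.snd
  have hN : Computable fun x : ℕ × ℕ × ℕ × ℕ => 2 ^ x.2.1 := computable_two_pow.comp hn
  have ht : Computable fun y : (ℕ × ℕ × ℕ × ℕ) × ℕ × ℕ => y.2.1 :=
    Computable.fst.comp Computable.snd
  have hdiv : Computable fun y : (ℕ × ℕ × ℕ × ℕ) × ℕ × ℕ => y.2.1 / 2 ^ y.1.2.1 :=
    Primrec.nat_div.to_comp.comp ht (hN.comp Computable.fst)
  have hmod : Computable fun y : (ℕ × ℕ × ℕ × ℕ) × ℕ × ℕ => y.2.1 % 2 ^ y.1.2.1 :=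
    Primrec.nat_mod.to_comp.comp ht (hN.comp Computable.fst)
  have hcol : Computable fun y : (ℕ × ℕ × ℕ × ℕ) × ℕ × ℕ =>
      tailColumnCode f y.1.1 y.1.2.1 y.2.1 y.2.2 :=
    Computable.cond (Primrec.nat_lt.decide.to_comp.comp (Computable.fst.comp Computable.fst) hdiv)
      (hf.comp (hdiv.pair ((hn.comp Computable.fst).pair
        ((Computable.snd.comp Computable.snd).pair hmod))))
      (Computable.const 0)
  exact Computable.entryCode hN
    (Computable.spanCode hN hcol (Primrec.nat_mul.to_comp.comp hn hN))
    (Computable.fst.comp (Computable.snd.comp Computable.snd))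
    (Computable.snd.comp (Computable.snd.comp Computable.snd))

theorem tailProj_eq_algNumber {S : ℕ → QSigma} {f : ℕ × ℕ × ℕ × ℕ → ℕ}
    (hf : ∀ (m n : ℕ) (i j : Fin (2 ^ n)),
      (S m).proj n i j = algNumber (f (m, n, (i : ℕ), (j : ℕ))))
    (m n : ℕ) (i j : Fin (2 ^ n)) :
    tailProj S m n i j = algNumber (tailProjCode f (m, n, (i : ℕ), (j : ℕ))) := by
  have hcol : tailColumn S m n =
      fun t (i : Fin (2 ^ n)) => algNumber (tailColumnCode f m n t i) := by
    ext t i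
    by_cases h : m < t / 2 ^ n <;> simp [tailColumn, tailColumnCode, h, hf, algNumber_zero]
  rw [tailProj, hcol, ← codedMatrix_spanCode]
  rfl

/-- The join of the quantum `Σ⁰₁` sets `S k` for `k > m`. -/
noncomputable def tailJoin (S : ℕ → QSigma) (hS : IsComputableSeq S) (m : ℕ) : QSigma where
  proj := tailProj S m
  special n := by
    obtain ⟨f, -, hf⟩ := hS
    refine ⟨(isHermitian_spanProj_and _ _).1, (isHermitian_spanProj_and _ _).2, fun i j => ?_⟩
    rw [tailProj_eq_algNumber hf]
    exact isAlgebraic_algNumber _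
  computable := by
    obtain ⟨f, hfc, hf⟩ := hS
    exact ⟨fun x => tailProjCode f (m, x),
      (computable_tailProjCode hfc).comp ((Computable.const m).pair Computable.id),
      tailProj_eq_algNumber hf m⟩
  range_le := range_tensorOne_tailProj_le S m

theorem isComputableSeq_tailJoin {S : ℕ → QSigma} (hS : IsComputableSeq S) :
    IsComputableSeq (tailJoin S hS) := by
  -- Here `id` keeps `hS` in the context, since `tailJoin S hS` in the goal depends on it.
  obtain ⟨f, hfc, hf⟩ := id hS
  exact ⟨tailProjCode f, computable_tailProjCode hfc, tailProj_eq_algNumber hf⟩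

/-! ### Measures of the tail joins -/

theorem finrank_finset_sup_le {κ V : Type*} [AddCommGroup V] [Module ℂ V] [FiniteDimensional ℂ V]
    (s : Finset κ) (W : κ → Submodule ℂ V) :
    Module.finrank ℂ (s.sup W : Submodule ℂ V) ≤ ∑ k ∈ s, Module.finrank ℂ (W k) := by
  classical
  induction s using Finset.induction_on with
  | empty => simp
  | insert a s ha ih =>
    rw [Finset.sup_insert, Finset.sum_insert ha]
    exact (Submodule.finrank_add_le_finrank_add_finrank _ _).trans (Nat.add_le_add_left ih _)

theorem sum_Ioo_inv_two_pow_le (m n : ℕ) :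
    ∑ k ∈ Finset.Ioo m n, ((2 : ℝ) ^ k)⁻¹ ≤ ((2 : ℝ) ^ m)⁻¹ := by
  -- The exact geometric sum, with its negative remainder, is what the induction can carry.
  have h : ∀ n, m + 1 ≤ n →
      ∑ k ∈ Finset.Ico (m + 1) n, ((2 : ℝ) ^ k)⁻¹ = ((2 : ℝ) ^ m)⁻¹ - 2 * ((2 : ℝ) ^ n)⁻¹ := by
    intro n hn
    induction n, hn using Nat.le_induction with
    | base => simp [pow_succ]
    | succ n hn ih =>
      rw [Finset.sum_Ico_succ_top hn, ih, pow_succ, mul_inv]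
      ring
  rcases le_or_gt (m + 1) n with hn | hn
  · change ∑ k ∈ Finset.Ico (m + 1) n, ((2 : ℝ) ^ k)⁻¹ ≤ _
    rw [h n hn]
    have : (0 : ℝ) ≤ ((2 : ℝ) ^ n)⁻¹ := by positivity
    linarith
  · rw [Finset.Ioo_eq_empty_of_le (by omega), Finset.sum_empty]
    positivity

/-- Subadditivity under joins is special to the tracial state, where it is subadditivity of
dimension; it can fail for other states. -/
theorem isQMLTest_tailJoin {S : ℕ → QSigma} (hS : IsQMLTest S) :
    IsQMLTest (tailJoin S hS.1) := by
  refine ⟨isComputableSeq_tailJoin hS.1, fun m => le_of_tendsto' (QState.tendsto_measure _ _)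
    fun n => ?_⟩
  rw [re_trace_tracialState_mul ((tailJoin S hS.1 m).special n).2.1]
  change _ * (Module.finrank ℂ (LinearMap.range (tailProj S m n).mulVecLin) : ℝ) ≤ _
  rw [range_tailProj]
  calc ((2 : ℝ) ^ n)⁻¹ * (Module.finrank ℂ ((Finset.Ioo m n).sup fun k =>
          LinearMap.range ((S k).proj n).mulVecLin : Submodule ℂ (Fin (2 ^ n) → ℂ)) : ℝ)
      ≤ ((2 : ℝ) ^ n)⁻¹ * ∑ k ∈ Finset.Ioo m n,
          (Module.finrank ℂ (LinearMap.range ((S k).proj n).mulVecLin) : ℝ) := by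
        gcongr
        exact_mod_cast finrank_finset_sup_le _ _
    _ = ∑ k ∈ Finset.Ioo m n, (Matrix.trace (tracialState.mat n * (S k).proj n)).re := by
        rw [Finset.mul_sum]
        exact Finset.sum_congr rfl fun k _ =>
          (re_trace_tracialState_mul ((S k).special n).2.1).symm
    _ ≤ ∑ k ∈ Finset.Ioo m n, ((2 : ℝ) ^ k)⁻¹ := Finset.sum_le_sum fun k _ =>
        (QState.re_trace_le_measure _ _ _).trans (hS.2 k)
    _ ≤ _ := sum_Ioo_inv_two_pow_le m n

theorem antitone_measure_tailJoin (ρ : QState) {S : ℕ → QSigma} (hS : IsComputableSeq S) :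
    Antitone fun m => ρ.measure (tailJoin S hS m) := by
  refine fun m m' h => ρ.measure_mono (.of_forall fun n => ?_)
  change LinearMap.range (tailProj S m' n).mulVecLin ≤ LinearMap.range (tailProj S m n).mulVecLin
  rw [range_tailProj, range_tailProj]
  exact Finset.sup_mono (Finset.Ioo_subset_Ioo_left h)

/-- The set `S (m + 1)` enters the join only at levels `n > m + 1`, so the ranges are compared
eventually. -/
theorem measure_succ_le_tailJoin (ρ : QState) {S : ℕ → QSigma} (hS : IsComputableSeq S) (m : ℕ) :
    ρ.measure (S (m + 1)) ≤ ρ.measure (tailJoin S hS m) := by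
  refine ρ.measure_mono ((Filter.eventually_gt_atTop (m + 1)).mono fun n hn => ?_)
  change _ ≤ LinearMap.range (tailProj S m n).mulVecLin
  rw [range_tailProj]
  exact Finset.le_sup (f := fun k => LinearMap.range ((S k).proj n).mulVecLin)
    (Finset.mem_Ioo.2 ⟨m.lt_succ_self, hn⟩)

/-- For a quantum Martin-Löf random state, the measures of any test tend to zero. -/
theorem IsQMLRandom.tendsto_measure_zero {ρ : QState} (hρ : IsQMLRandom ρ) {S : ℕ → QSigma}
    (hS : IsQMLTest S) : Filter.Tendsto (fun m => ρ.measure (S m)) Filter.atTop (nhds 0) := by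
  have h := tendsto_atTop_ciInf (antitone_measure_tailJoin ρ hS.1)
    ⟨0, by rintro _ ⟨m, rfl⟩; exact ρ.measure_nonneg _⟩
  rw [hρ _ (isQMLTest_tailJoin hS)] at h
  rw [← Filter.tendsto_add_atTop_iff_nat 1]
  exact squeeze_zero (fun m => ρ.measure_nonneg _) (measure_succ_le_tailJoin ρ hS.1) h

end QRandom

theorem corollary2p15 {k : ℕ} (ρ : Fin k → QRandom.QState) (α : Fin k → ℝ)
    (hα : ∀ i, 0 ≤ α i) (hsum : ∑ i, α i = 1)
    (hρ : ∀ i, QRandom.IsQMLRandom (ρ i)) :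
    QRandom.IsQMLRandom (QRandom.QState.convexComb ρ α hα hsum) := by
  intro S hS
  have hlim : Filter.Tendsto
      (fun m => (QRandom.QState.convexComb ρ α hα hsum).measure (S m)) Filter.atTop (nhds 0) := by
    simp only [QRandom.QState.measure_convexComb]
    simpa using tendsto_finsetSum Finset.univ fun i _ =>
      ((hρ i).tendsto_measure_zero hS).const_mul (α i)
  -- The infimum is below every term, hence below their limit `0`.
  refine le_antisymm (ge_of_tendsto' hlim fun m => ciInf_le ⟨0, ?_⟩ m)
    (Real.iInf_nonneg fun m => QRandom.QState.measure_nonneg _ _)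
  rintro _ ⟨m, rfl⟩
  exact QRandom.QState.measure_nonneg _ _
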